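/- For groups $D,Q$ let $D\wr Q=D^{(Q)}\rtimes Q$ denote the restricted wreath product, where $D^{(Q)}$ is the group of finitely supported functions $Q\to D$ and $Q$ acts on it by translation of the argument. Let $\mathcal T_2$ be the binary rooted tree, whose vertices are the finite words over a two-letter alphabet ordered by the prefix relation, and let $\mathcal A_2=\mathrm{Aut}(\mathcal T_2)$. For $\alpha\in\mathcal A_2$ and a word $u$, the state $\alpha_u\in\mathcal A_2$ is the automorphism determined by $\alpha(uv)=\alpha(u)\,\alpha_u(v)$ for all words $v$; $\alpha$ is finite-state if $\{\alpha_u\}_u$ is finite, and $\mathcal F_2\le\mathcal A_2$ denotes the group of all finite-state automorphisms. A subgroup $G\le\mathcal A_2$ is called an automata group (on two letters) if it is finitely generated, contains every state of each of its elements, and is contained in $\mathcal F_2$. Theorem. The group $W_3(\mathbb Z)=\mathbb Z\wr(\mathbb Z\wr\mathbb Z)$ is isomorphic to a subgroup of $\mathcal F_2$; moreover, there is an injective homomorphism $W_3(\mathbb Z)\to\mathcal F_2$ whose image is contained in a two-letter automata group $G\le\mathcal A_2$. -/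

import Mathlib

/-- The restricted (regular) wreath product `D ≀ Q`, realised inside the unrestricted one as the
subgroup of the pairs `(f, q)` whose function `f : Q → D` has finite support. -/
def restrictedWreathSubgroup (D Q : Type*) [Group D] [Group Q] :
    Subgroup (RegularWreathProduct D Q) where
  carrier := {w | (Function.mulSupport w.left).Finite}
  one_mem' := by simp
  mul_mem' := by
    intro a b ha hb
    have hb' : (Function.mulSupport fun x => b.left (a.right⁻¹ * x)).Finite :=
      Set.Finite.preimage (mul_right_injective a.right⁻¹).injOn hb
    exact (ha.union hb').subset (Function.mulSupport_mul a.left _)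
  inv_mem' := by
    intro a ha
    have ha' : (Function.mulSupport fun x => a.left (a.right * x)).Finite :=
      Set.Finite.preimage (mul_right_injective a.right).injOn ha
    refine ha'.subset ?_
    intro x hx
    simpa using hx

/-- The restricted wreath product `D ≀ Q = D^(Q) ⋊ Q` as a group. -/
abbrev RestrictedWreath (D Q : Type*) [Group D] [Group Q] : Type _ :=
  restrictedWreathSubgroup D Q

/-- `W₃(ℤ) = ℤ ≀ (ℤ ≀ ℤ)`, with `ℤ` written multiplicatively. -/
abbrev W3 : Type :=
  RestrictedWreath (Multiplicative ℤ)
    (RestrictedWreath (Multiplicative ℤ) (Multiplicative ℤ))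

/-- The automorphism group of the one-rooted `m`-regular tree: the vertices are the finite words
over `m` letters, and automorphisms are the bijections that preserve and reflect the prefix
order. -/
abbrev TreeAut (m : ℕ) : Type :=
  ((· <+: ·) : List (Fin m) → List (Fin m) → Prop) ≃r
    ((· <+: ·) : List (Fin m) → List (Fin m) → Prop)

namespace TreeAut

variable {m : ℕ}

theorem length_le (α : TreeAut m) (u : List (Fin m)) : u.length ≤ (α u).length := by
  induction u using List.reverseRecOn with
  | nil => simp
  | append_singleton w a ih =>
    have h1 : α w <+: α (w ++ [a]) := α.map_rel_iff.2 (List.prefix_append w [a])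
    have h2 : (α w).length ≠ (α (w ++ [a])).length := fun h => by
      have h3 := α.injective (h1.eq_of_length h)
      simp at h3
    have h4 := h1.length_le
    simp only [List.length_append, List.length_singleton]
    omega

theorem length_eq (α : TreeAut m) (u : List (Fin m)) : (α u).length = u.length := by
  refine le_antisymm ?_ (length_le α u)
  have h := length_le α.symm (α u)
  rwa [RelIso.symm_apply_apply] at h

theorem apply_append (α : TreeAut m) (u v : List (Fin m)) :
    α (u ++ v) = α u ++ (α (u ++ v)).drop u.length := by
  obtain ⟨t, ht⟩ := (α.map_rel_iff (a := u) (b := u ++ v)).2 (List.prefix_append u v)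
  rw [← ht, ← length_eq α u, List.drop_left]

/-- The state `α_u` of `α` at the vertex `u`: the automorphism with
`α (u ++ v) = α u ++ α_u v` for all words `v`. -/
def state (α : TreeAut m) (u : List (Fin m)) : TreeAut m where
  toFun v := (α (u ++ v)).drop u.length
  invFun v := (α.symm (α u ++ v)).drop u.length
  left_inv v := by
    beta_reduce
    rw [← apply_append, RelIso.symm_apply_apply, List.drop_left]
  right_inv v := by
    have h := apply_append α.symm (α u) v
    rw [RelIso.symm_apply_apply, length_eq] at h
    beta_reduce
    rw [← h, RelIso.apply_symm_apply, ← length_eq α u, List.drop_left]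
  map_rel_iff' := by
    intro v w
    have h := α.map_rel_iff (a := u ++ v) (b := u ++ w)
    rw [apply_append α u v, apply_append α u w, List.prefix_append_right_inj,
      List.prefix_append_right_inj] at h
    exact h

theorem apply_append_state (α : TreeAut m) (u v : List (Fin m)) :
    α (u ++ v) = α u ++ state α u v :=
  apply_append α u v

theorem state_one (u : List (Fin m)) : state (1 : TreeAut m) u = 1 := by
  ext1 v
  refine List.append_cancel_left (as := u) ?_
  exact (apply_append_state (1 : TreeAut m) u v).symm

theorem state_mul (α β : TreeAut m) (u : List (Fin m)) :
    state (α * β) u = state α (β u) * state β u := by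
  ext1 v
  refine List.append_cancel_left (as := (α * β) u) ?_
  rw [← apply_append_state, RelIso.mul_apply, RelIso.mul_apply, RelIso.mul_apply,
    apply_append_state β, apply_append_state α]

theorem state_inv (α : TreeAut m) (u : List (Fin m)) :
    state α⁻¹ u = (state α (α⁻¹ u))⁻¹ := by
  have h := state_mul α α⁻¹ u
  rw [mul_inv_cancel, state_one] at h
  exact (inv_eq_of_mul_eq_one_right h.symm).symm

/-- The set `Q(α)` of all states of `α`. -/
def states (α : TreeAut m) : Set (TreeAut m) :=
  Set.range (state α)

/-- `α` is finite-state if it has only finitely many states. -/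
def IsFiniteState (α : TreeAut m) : Prop :=
  (states α).Finite

end TreeAut

/-- The group `F_m` of finite-state automorphisms of the `m`-regular rooted tree. -/
def finiteStateGroup (m : ℕ) : Subgroup (TreeAut m) where
  carrier := {α | TreeAut.IsFiniteState α}
  one_mem' := by
    refine (Set.finite_singleton (1 : TreeAut m)).subset ?_
    rintro _ ⟨u, rfl⟩
    exact TreeAut.state_one u
  mul_mem' := by
    intro α β hα hβ
    refine (Set.Finite.image2 (fun a b => a * b) hα hβ).subset ?_
    rintro _ ⟨u, rfl⟩
    exact ⟨_, ⟨β u, rfl⟩, _, ⟨u, rfl⟩, (TreeAut.state_mul α β u).symm⟩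
  inv_mem' := by
    intro α hα
    refine (Set.Finite.image (fun a => a⁻¹) hα).subset ?_
    rintro _ ⟨u, rfl⟩
    exact ⟨_, ⟨α⁻¹ u, rfl⟩, (TreeAut.state_inv α u).symm⟩

/-- A subgroup of `TreeAut m` is an automata group (on `m` letters) if it is finitely generated,
state-closed and finite-state. -/
structure IsAutomataGroup {m : ℕ} (G : Subgroup (TreeAut m)) : Prop where
  fg : G.FG
  stateClosed : ∀ α ∈ G, TreeAut.states α ⊆ G
  finiteState : G ≤ finiteStateGroup m

/-! The wreath product is built by an inductive step: from a faithful finite-state action of `Q` on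
the binary tree, produce one of `ℤ ≀ Q`. Start from the odometer for `ℤ` and apply the step twice.

Interleave three words `x`, `e`, `y`. Let `Q` move `x`, keep `e` fixed, and let the lamp add `∑ 2 ^
i` to the binary number `y`, the sum running over those `i` for which the prefixes of `x` and `e` of
length `i + 1` agree. The lamp needs only to remember whether the prefixes still agree and a carry
bit, so it is finite-state. Its conjugate by `h` compares `h⁻¹ x` with `e` instead; all these
conjugates change only `y`, by amounts independent of `y`, so they commute (`skewFun_comp`,
`cocycle_mul`).

For faithfulness, the value `f a` of a base element must be isolated. If one word `u` is moved by
every `h⁻¹ a` with `h ≠ a` in the support of `f`, let `e` start with `u` and `x` with `a u`: beyond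
these prefixes only the summand of `a` survives, and varying the tails forces `f a = 0`
(`eq_zero_of_skew_indicator_eq_one`).

A faithful action need not have such a word, since nontrivial elements may have disjoint supports.
Restarting repairs this: flag letters let the action begin anew, so words moved by the individual
elements can be concatenated (`exists_forall_restartHom_ne`). -/

namespace TreeAut

/-! ### States, first-level permutations and a finiteness criterion -/

/-- The tree automorphism given by a pair of mutually inverse prefix-preserving maps on words. -/
def ofPrefixMaps {m : ℕ} (f g : List (Fin m) → List (Fin m)) (hgf : ∀ u, g (f u) = u)
    (hfg : ∀ u, f (g u) = u) (hf : ∀ u v, f u <+: f (u ++ v)) (hg : ∀ u v, g u <+: g (u ++ v)) :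
    TreeAut m where
  toFun := f
  invFun := g
  left_inv := hgf
  right_inv := hfg
  map_rel_iff' := by
    intro u v
    constructor
    · rintro ⟨t, ht⟩
      have h := hg (f u) t
      simp only [Equiv.coe_fn_mk] at ht
      rwa [ht, hgf, hgf] at h
    · rintro ⟨t, rfl⟩
      exact hf u t

theorem state_append {m : ℕ} (α : TreeAut m) (u v : List (Fin m)) :
    state α (u ++ v) = state (state α u) v := by
  ext1 w
  have h := apply_append_state α (u ++ v) w
  rw [List.append_assoc, apply_append_state α u, apply_append_state α u v,
    apply_append_state (state α u), ← List.append_assoc] at h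
  exact (List.append_cancel_left h).symm

theorem state_nil {m : ℕ} (α : TreeAut m) : state α [] = α := by
  ext1 w
  have h := apply_append_state α [] w
  have h0 : α [] = [] := List.length_eq_zero_iff.1 (length_eq α [])
  rw [h0] at h
  simpa using h.symm

/-- The permutation of the alphabet induced by a tree automorphism on the first level. -/
def letter (α : TreeAut 2) (x : Fin 2) : Fin 2 := (α [x]).headI

theorem apply_singleton (α : TreeAut 2) (x : Fin 2) : α [x] = [letter α x] := by
  obtain ⟨y, hy⟩ := List.length_eq_one_iff.1 (length_eq α [x])
  simp [letter, hy]

theorem apply_nil (α : TreeAut 2) : α [] = [] := List.length_eq_zero_iff.1 (length_eq α [])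

theorem apply_cons (α : TreeAut 2) (x : Fin 2) (v : List (Fin 2)) :
    α (x :: v) = letter α x :: state α [x] v := by
  have h := apply_append_state α [x] v
  rwa [apply_singleton] at h

theorem letter_one (x : Fin 2) : letter 1 x = x := rfl

theorem letter_mul (α β : TreeAut 2) (x : Fin 2) :
    letter (α * β) x = letter α (letter β x) := by
  have h : (α * β) [x] = α (β [x]) := rfl
  rw [apply_singleton, apply_singleton β, apply_singleton α] at h
  simpa using h

theorem state_mul_singleton (α β : TreeAut 2) (x : Fin 2) :
    state (α * β) [x] = state α [letter β x] * state β [x] := by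
  rw [state_mul, apply_singleton]

theorem inv_apply_cons_letter (α : TreeAut 2) (x : Fin 2) (v : List (Fin 2)) :
    α⁻¹ (letter α x :: v) = x :: (state α [x])⁻¹ v := by
  have h : α⁻¹ (α (x :: (state α [x])⁻¹ v)) = x :: (state α [x])⁻¹ v := by
    rw [← RelIso.mul_apply, inv_mul_cancel]; rfl
  rwa [apply_cons, ← RelIso.mul_apply, mul_inv_cancel] at h

/-- An automorphism in a finite set closed under passing to the states at words of a fixed positive
length `k` is finite-state. -/
theorem isFiniteState_of_mem {m k : ℕ} (hk : 0 < k) {T : Set (TreeAut m)} (hT : T.Finite)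
    (h : ∀ α ∈ T, ∀ u : List (Fin m), u.length = k → state α u ∈ T) {α : TreeAut m}
    (hα : α ∈ T) : IsFiniteState α := by
  have hfin : {u : List (Fin m) | u.length < k}.Finite := List.finite_length_lt (Fin m) k
  refine (Set.Finite.image2 state hT hfin).subset ?_
  rintro _ ⟨u, rfl⟩
  induction hn : u.length using Nat.strong_induction_on generalizing u α with
  | _ n ih =>
    by_cases hu : u.length < k
    · exact ⟨α, hα, u, hu, rfl⟩
    · rw [← List.take_append_drop k u, state_append]
      refine ih (u.drop k).length ?_ (h α hα (u.take k) ?_) _ rfl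
      · simp; omega
      · simp; omega

/-! ### Restarting an automorphism -/

/-- Let `β` act on the letters at even positions, the letters at odd positions being
fixed; after each letter `1` at an odd position, the action continues with `α`. -/
def restartFun (α : TreeAut 2) : TreeAut 2 → List (Fin 2) → List (Fin 2)
  | _, [] => []
  | β, [x] => [letter β x]
  | β, x :: b :: u => letter β x :: b :: restartFun α (if b = 1 then α else state β [x]) u

/-- The flags at odd positions are fixed, so both factors restart at the same places. -/
theorem restartFun_mul (α β : TreeAut 2) : ∀ (α' β' : TreeAut 2) (u : List (Fin 2)),
    restartFun (α * β) (α' * β') u = restartFun α α' (restartFun β β' u)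
  | _, _, [] => by simp [restartFun]
  | _, _, [x] => by simp [restartFun, letter_mul]
  | α', β', x :: b :: u => by
    simp only [restartFun, letter_mul, List.cons.injEq, true_and]
    rw [← restartFun_mul α β]
    split_ifs
    · rfl
    · rw [state_mul_singleton]

theorem restartFun_one : ∀ u : List (Fin 2), restartFun 1 1 u = u
  | [] => rfl
  | [x] => rfl
  | x :: b :: u => by
    simp only [restartFun, state_one, ite_self, letter_one]
    rw [restartFun_one u]

theorem restartFun_prefix_append (α : TreeAut 2) : ∀ (β : TreeAut 2) (u v : List (Fin 2)),
    restartFun α β u <+: restartFun α β (u ++ v)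
  | _, [], _ => by simp [restartFun]
  | _, [x], [] => by simp
  | _, [x], b :: v => by simp [restartFun]
  | β, x :: b :: u, v => by
    simp only [restartFun, List.cons_append, List.cons_prefix_cons, true_and]
    exact restartFun_prefix_append α _ u v

/-- `restartFun` as a tree automorphism. -/
def restart (α β : TreeAut 2) : TreeAut 2 :=
  ofPrefixMaps (restartFun α β) (restartFun α⁻¹ β⁻¹)
    (fun u => by rw [← restartFun_mul, inv_mul_cancel, inv_mul_cancel, restartFun_one])
    (fun u => by rw [← restartFun_mul, mul_inv_cancel, mul_inv_cancel, restartFun_one])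
    (restartFun_prefix_append α β) (restartFun_prefix_append _ _)

theorem restart_apply (α β : TreeAut 2) (u : List (Fin 2)) :
    restart α β u = restartFun α β u := rfl

theorem state_restart (α β : TreeAut 2) (x b : Fin 2) :
    state (restart α β) [x, b] = restart α (if b = 1 then α else state β [x]) := by
  ext1 v
  have h := apply_append_state (restart α β) [x, b] v
  simp only [restart_apply, List.cons_append, List.nil_append, restartFun] at h
  simpa [restart_apply] using h.symm

/-- The homomorphism `α ↦ restart α α`. -/
def restartHom : TreeAut 2 →* TreeAut 2 :=
  MonoidHom.mk' (fun α => restart α α) fun α β => by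
    ext1 u
    exact restartFun_mul α β α β u

theorem restartHom_isFiniteState {α : TreeAut 2} (hα : IsFiniteState α) :
    IsFiniteState (restartHom α) := by
  refine isFiniteState_of_mem (k := 2) two_pos (T := restart α '' states α) (hα.image _) ?_
    ⟨α, ⟨[], state_nil α⟩, rfl⟩
  rintro _ ⟨_, ⟨w, rfl⟩, rfl⟩ u hu
  obtain ⟨x, b, rfl⟩ := List.length_eq_two.1 hu
  rw [state_restart]
  refine Set.mem_image_of_mem _ ?_
  split_ifs
  · exact ⟨[], state_nil α⟩
  · exact ⟨w ++ [x], state_append α w [x]⟩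

/-- The word `v` on the even positions, with a restart after its last letter. -/
def blockCode : List (Fin 2) → List (Fin 2)
  | [] => []
  | [x] => [x, 1]
  | x :: y :: v => x :: 0 :: blockCode (y :: v)

/-- The flags `0` let `β` run through `v`; the final flag `1` hands the rest over to a fresh copy of
`α`. -/
theorem restartFun_blockCode_append (α : TreeAut 2) : ∀ (β : TreeAut 2) (v u : List (Fin 2)),
    v ≠ [] → restartFun α β (blockCode v ++ u) = blockCode (β v) ++ restartFun α α u
  | _, [], _, h => absurd rfl h
  | β, [x], u, _ => by simp [blockCode, restartFun, apply_singleton]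
  | β, x :: y :: v, u, _ => by
    simp only [blockCode, List.cons_append, restartFun, zero_ne_one, if_false]
    rw [restartFun_blockCode_append α _ (y :: v) u (by simp), apply_cons β,
      apply_cons (state β [x])]
    rfl

theorem blockCode_injective : Function.Injective blockCode
  | [], [], _ => rfl
  | [], [_], h => by simp [blockCode] at h
  | [], _ :: _ :: _, h => by simp [blockCode] at h
  | [_], [], h => by simp [blockCode] at h
  | _ :: _ :: _, [], h => by simp [blockCode] at h
  | [x], [y], h => by simpa [blockCode] using h
  | [x], _ :: _ :: _, h => by simp [blockCode] at h
  | _ :: _ :: _, [x], h => by simp [blockCode] at h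
  | x :: y :: v, x' :: y' :: v', h => by
    simp only [blockCode, List.cons.injEq, true_and] at h
    rw [h.1, blockCode_injective h.2]

/-- Finitely many nontrivial automorphisms move a common word once they are restarted. -/
theorem exists_forall_restartHom_ne (F : Finset (TreeAut 2)) (hF : 1 ∉ F) :
    ∃ w, ∀ α ∈ F, restartHom α w ≠ w := by
  classical
  induction F using Finset.induction_on with
  | empty => exact ⟨[], by simp⟩
  | insert β F _ ih =>
    obtain ⟨w, hw⟩ := ih fun h => hF (Finset.mem_insert_of_mem h)
    have hβ : β ≠ 1 := fun h => hF (h ▸ Finset.mem_insert_self β F)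
    obtain ⟨v, hv⟩ : ∃ v, β v ≠ v := by
      by_contra! h
      exact hβ (RelIso.ext h)
    have hv0 : v ≠ [] := by
      rintro rfl
      exact hv (apply_nil β)
    -- Each restarted `α` acts on the two blocks separately: `β` moves the first, the members of `F`
    -- move the second.
    refine ⟨blockCode v ++ w, fun α hα h => ?_⟩
    change restartFun α α (blockCode v ++ w) = _ at h
    rw [restartFun_blockCode_append α α v w hv0] at h
    have hlen : (restartFun α α w).length = w.length := length_eq (restart α α) w
    obtain ⟨h1, h2⟩ := List.append_inj' h hlen
    rcases Finset.mem_insert.1 hα with rfl | hα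
    · exact hv (blockCode_injective h1)
    · exact hw α hα h2

/-! ### Skew products with the binary odometer -/

/-- The parity of an integer, as a letter. -/
def parity (z : ℤ) : Fin 2 := if z % 2 = 0 then 0 else 1

/-- A letter as an integer. -/
def digit (y : Fin 2) : ℤ := if y = 0 then 0 else 1

theorem digit_parity (z : ℤ) : digit (parity z) = z % 2 := by
  unfold digit parity
  split_ifs <;> omega

theorem parity_digit (y : Fin 2) : parity (digit y) = y := by
  fin_cases y <;> rfl

theorem parity_congr {a b : ℤ} (h : a % 2 = b % 2) : parity a = parity b := by
  simp [parity, h]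

theorem digit_mem (y : Fin 2) : digit y = 0 ∨ digit y = 1 := by
  unfold digit; split_ifs <;> simp

/-- The function `K` of two words, with `x` and `e` prepended to its arguments. -/
def shift (K : List (Fin 2) → List (Fin 2) → ℤ) (x e : Fin 2) :
    List (Fin 2) → List (Fin 2) → ℤ :=
  fun xs es => K (x :: xs) (e :: es)

/-- Words are read as three interleaved words `(x, e, y)`. The first one is moved by `α`, the second
one is fixed, and to the binary expansion `y` (least significant digit first) we add
`n + ∑ i, 2 ^ i * K xᵢ eᵢ`, where `xᵢ` and `eᵢ` are the prefixes of length `i + 1` of the image of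
`x` and of `e`. -/
def skewFun : TreeAut 2 → (List (Fin 2) → List (Fin 2) → ℤ) → ℤ → List (Fin 2) → List (Fin 2)
  | _, _, _, [] => []
  | α, _, _, [x] => [letter α x]
  | α, _, _, [x, e] => [letter α x, e]
  | α, K, n, x :: e :: y :: u =>
    letter α x :: e :: parity (digit y + n + K [letter α x] [e]) ::
      skewFun (state α [x]) (shift K (letter α x) e)
        ((digit y + n + K [letter α x] [e]) / 2) u

/-- `L` sees the `x`-word before `α` is applied, hence `α⁻¹`. Carries add up because `(s % 2 + t) /
2 + s / 2 = (s + t) / 2`. -/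
theorem skewFun_comp : ∀ (α β : TreeAut 2) (K L : List (Fin 2) → List (Fin 2) → ℤ) (m n : ℤ)
    (u : List (Fin 2)), skewFun α K m (skewFun β L n u) =
      skewFun (α * β) (fun xs es => K xs es + L (α⁻¹ xs) es) (m + n) u
  | _, _, _, _, _, _, [] => by simp [skewFun]
  | _, _, _, _, _, _, [x] => by simp [skewFun, letter_mul]
  | _, _, _, _, _, _, [x, e] => by simp [skewFun, letter_mul]
  | α, β, K, L, m, n, x :: e :: y :: u => by
    simp only [skewFun, letter_mul, digit_parity]
    have h1 : α⁻¹ [letter α (letter β x)] = [letter β x] := by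
      rw [inv_apply_cons_letter, apply_nil]
    have h2 : shift (fun xs es => K xs es + L (α⁻¹ xs) es) (letter α (letter β x)) e =
        fun xs es => shift K (letter α (letter β x)) e xs es +
          shift L (letter β x) e ((state α [letter β x])⁻¹ xs) es := by
      funext xs es
      simp only [shift, inv_apply_cons_letter]
    rw [skewFun_comp, h1, h2, state_mul_singleton]
    congr 3
    · apply parity_congr
      omega
    · congr 1
      omega

theorem skewFun_one : ∀ u : List (Fin 2), skewFun 1 0 0 u = u
  | [] => rfl
  | [x] => rfl
  | [x, e] => rfl
  | x :: e :: y :: u => by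
    have h : digit y / 2 = 0 := by rcases digit_mem y with h | h <;> rw [h] <;> rfl
    have h0 : shift 0 x e = 0 := rfl
    simp [skewFun, letter_one, parity_digit, state_one, h, h0, skewFun_one u]

theorem skewFun_prefix_append : ∀ (α : TreeAut 2) (K : List (Fin 2) → List (Fin 2) → ℤ) (n : ℤ)
    (u v : List (Fin 2)), skewFun α K n u <+: skewFun α K n (u ++ v)
  | _, _, _, [], _ => by simp [skewFun]
  | _, _, _, [x], [] => by simp
  | _, _, _, [x], [e] => by simp [skewFun]
  | _, _, _, [x], e :: y :: v => by simp [skewFun]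
  | _, _, _, [x, e], [] => by simp
  | _, _, _, [x, e], y :: v => by simp [skewFun]
  | α, K, n, x :: e :: y :: u, v => by
    simp only [skewFun, List.cons_append, List.cons_prefix_cons, true_and]
    exact skewFun_prefix_append _ _ _ u v

/-- `skewFun` as a tree automorphism. -/
def skew (α : TreeAut 2) (K : List (Fin 2) → List (Fin 2) → ℤ) (n : ℤ) : TreeAut 2 :=
  ofPrefixMaps (skewFun α K n) (skewFun α⁻¹ (fun xs es => -K (α xs) es) (-n))
    (fun u => by
      rw [skewFun_comp, inv_mul_cancel, neg_add_cancel, inv_inv]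
      convert skewFun_one u using 2
      funext xs es
      simp)
    (fun u => by
      rw [skewFun_comp, mul_inv_cancel, add_neg_cancel]
      convert skewFun_one u using 2
      funext xs es
      rw [← RelIso.mul_apply, mul_inv_cancel]
      simp)
    (skewFun_prefix_append _ _ _) (skewFun_prefix_append _ _ _)

theorem skew_apply (α : TreeAut 2) (K : List (Fin 2) → List (Fin 2) → ℤ) (n : ℤ)
    (u : List (Fin 2)) : skew α K n u = skewFun α K n u := rfl

theorem skew_mul (α β : TreeAut 2) (K L : List (Fin 2) → List (Fin 2) → ℤ) (m n : ℤ) :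
    skew α K m * skew β L n =
      skew (α * β) (fun xs es => K xs es + L (α⁻¹ xs) es) (m + n) := by
  ext1 u
  exact skewFun_comp α β K L m n u

theorem state_skew (α : TreeAut 2) (K : List (Fin 2) → List (Fin 2) → ℤ) (n : ℤ)
    (x e y : Fin 2) : state (skew α K n) [x, e, y] =
      skew (state α [x]) (shift K (letter α x) e)
        ((digit y + n + K [letter α x] [e]) / 2) := by
  ext1 v
  have h := apply_append_state (skew α K n) [x, e, y] v
  simp only [skew_apply, List.cons_append, List.nil_append, skewFun] at h
  simpa [skew_apply] using h.symm

theorem parity_eq_of_skew_eq_one {α : TreeAut 2} {K : List (Fin 2) → List (Fin 2) → ℤ} {n : ℤ}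
    (h : skew α K n = 1) (x e y : Fin 2) :
    letter α x = x ∧ parity (digit y + n + K [letter α x] [e]) = y := by
  have h1 : skewFun α K n [x, e, y] = [x, e, y] := DFunLike.congr_fun h [x, e, y]
  simpa [skewFun] using h1

theorem state_of_skew_eq_one {α : TreeAut 2} {K : List (Fin 2) → List (Fin 2) → ℤ} {n : ℤ}
    (h : skew α K n = 1) (x e y : Fin 2) :
    skew (state α [x]) (shift K (letter α x) e)
        ((digit y + n + K [letter α x] [e]) / 2) = 1 := by
  rw [← state_skew, h, state_one]

/-- The `x`-coordinate evolves by `α` alone, whatever `e` and `y` are. -/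
theorem eq_one_of_skew_eq_one {α : TreeAut 2} {K : List (Fin 2) → List (Fin 2) → ℤ} {n : ℤ}
    (h : skew α K n = 1) : α = 1 := by
  refine RelIso.ext fun v => ?_
  change α v = v
  induction v generalizing α K n with
  | nil => exact apply_nil α
  | cons x v ih =>
    rw [apply_cons, (parity_eq_of_skew_eq_one h x 0 0).1, ih (state_of_skew_eq_one h x 0 0)]

/-- If a skew product is trivial, then so is some skew product with the same function on pairs of
words, restricted to the pairs with given prefixes of equal length. -/
theorem exists_skew_append_eq_one (xs es : List (Fin 2)) (hlen : xs.length = es.length)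
    {K : List (Fin 2) → List (Fin 2) → ℤ} {n : ℤ} (h : skew 1 K n = 1) :
    ∃ m, skew 1 (fun xs' es' => K (xs ++ xs') (es ++ es')) m = 1 := by
  induction xs generalizing es K n with
  | nil =>
    obtain rfl : es = [] := List.length_eq_zero_iff.1 hlen.symm
    exact ⟨n, h⟩
  | cons x xs ih =>
    match es, hlen with
    | e :: es, hlen =>
      have h1 := state_of_skew_eq_one h x e 0
      rw [state_one, letter_one] at h1
      exact ih es (by simpa using hlen) h1

/-- The first digit of `y` shows that `n` is even, and the state carries `n / 2`: descent on `|n|`.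
-/
theorem eq_zero_of_skew_zero_eq_one {n : ℤ} (h : skew 1 0 n = 1) : n = 0 := by
  induction hk : n.natAbs using Nat.strong_induction_on generalizing n with
  | _ k ih =>
    by_contra hn
    have h1 := congrArg digit (parity_eq_of_skew_eq_one h 0 0 0).2
    rw [digit_parity] at h1
    have h2 := state_of_skew_eq_one h 0 0 0
    have h3 : digit 0 = 0 := rfl
    simp only [h3, zero_add, Pi.zero_apply, add_zero, state_one] at h1 h2
    have h4 := ih _ (by omega) h2 rfl
    omega

theorem eq_zero_of_skew_indicator_eq_one (β : TreeAut 2) {k n : ℤ}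
    (h : skew 1 (fun xs es => if β xs = es then k else 0) n = 1) : k = 0 := by
  have key : ∀ (β : TreeAut 2) (n : ℤ),
      skew 1 (fun xs es => if β xs = es then k else 0) n = 1 → n = 0 := by
    intro β n h
    -- A mismatch at the first letter kills the indicator for good, leaving the plain odometer
    -- power.
    obtain ⟨e, he⟩ : ∃ e, letter β 0 ≠ e :=
      (exists_ne (letter β 0)).imp fun _ h => h.symm
    have h1 := congrArg digit (parity_eq_of_skew_eq_one h 0 e 0).2
    have h2 := state_of_skew_eq_one h 0 e 0
    have h3 : shift (fun xs es => if β xs = es then k else 0) 0 e = 0 := by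
      funext xs es
      simp [shift, apply_cons, he]
    have h4 : digit 0 = 0 := rfl
    simp only [digit_parity, letter_one, state_one, h3, apply_singleton, List.cons.injEq, he,
      false_and, if_false, h4] at h1 h2
    have h5 := eq_zero_of_skew_zero_eq_one h2
    omega
  have h0 := key β n h
  have h3 : shift (fun xs es => if β xs = es then k else 0) 0 (letter β 0) =
      fun xs es => if state β [0] xs = es then k else 0 := by
    funext xs es
    simp [shift, apply_cons]
  -- After a matching letter the state has the same shape, so its carry vanishes too. With `n = 0`,
  -- both `k` and `k + 1` then lie in `{0, 1}`.
  have h1 : ∀ y, (digit y + n + k) / 2 = 0 := by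
    intro y
    have h2 := state_of_skew_eq_one h 0 (letter β 0) y
    simp only [letter_one, state_one, h3, apply_singleton, if_true] at h2
    exact key _ _ h2
  have hy0 := h1 0
  have hy1 := h1 1
  have d0 : digit 0 = 0 := rfl
  have d1 : digit 1 = 1 := rfl
  omega

end TreeAut


open TreeAut

/-! ### The base case: the odometer -/

/-- Some faithful action of `Q` on the binary tree is by finite-state automorphisms. -/
def EmbedsInFiniteState (Q : Type*) [Group Q] : Prop :=
  ∃ ρ : Q →* TreeAut 2, Function.Injective ρ ∧ ∀ q, IsFiniteState (ρ q)

theorem embedsInFiniteState_int : EmbedsInFiniteState (Multiplicative ℤ) := by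
  let ρ : Multiplicative ℤ →* TreeAut 2 :=
    MonoidHom.mk' (fun n => skew 1 0 n.toAdd) fun m n => by
      rw [skew_mul, mul_one, toAdd_mul]
      congr 1
  refine ⟨ρ, (injective_iff_map_eq_one ρ).2 fun n hn => ?_, fun n => ?_⟩
  · exact Multiplicative.toAdd.injective (eq_zero_of_skew_zero_eq_one hn)
  · have h1 : IsFiniteState (ρ (Multiplicative.ofAdd 1)) := by
      -- The carry of the odometer stays in `{0, 1}`.
      refine isFiniteState_of_mem (k := 3) three_pos (T := skew 1 0 '' {0, 1})
        (Set.toFinite _) ?_ ⟨1, by simp, rfl⟩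
      rintro _ ⟨n, hn, rfl⟩ u hu
      obtain ⟨x, e, y, rfl⟩ := List.length_eq_three.1 hu
      rw [state_skew, state_one]
      refine ⟨_, ?_, rfl⟩
      simp only [Set.mem_insert_iff, Set.mem_singleton_iff, Pi.zero_apply] at hn ⊢
      have := digit_mem y
      omega
    have h2 : ρ n = ρ (Multiplicative.ofAdd 1) ^ n.toAdd := by
      rw [← map_zpow, ← ofAdd_zsmul]
      simp
    rw [h2]
    exact (finiteStateGroup 2).zpow_mem h1 _

/-! ### Generators of `ℤ ≀ Q` -/

namespace RestrictedWreath

variable {Q : Type*} [Group Q]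

/-- The inclusion of `Q` into `ℤ ≀ Q`. -/
def top : Q →* RestrictedWreath (Multiplicative ℤ) Q where
  toFun q := ⟨RegularWreathProduct.inl q, by simp [restrictedWreathSubgroup]⟩
  map_one' := by simp
  map_mul' p q := by simp [Subtype.ext_iff]

/-- The generator of the copy of `ℤ` at the identity of `Q` in `ℤ ≀ Q`. -/
noncomputable def lamp : RestrictedWreath (Multiplicative ℤ) Q :=
  open Classical in
  ⟨⟨Pi.mulSingle 1 (Multiplicative.ofAdd 1), 1⟩,
    (Set.finite_singleton (1 : Q)).subset Pi.mulSupport_mulSingle_subset⟩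

theorem lamp_left (q : Q) [Decidable (q = 1)] : (lamp (Q := Q)).1.left q =
    if q = 1 then Multiplicative.ofAdd (1 : ℤ) else 1 := by
  classical
  simp only [lamp, Pi.mulSingle_apply]
  congr

theorem lamp_zpow (n : ℤ) [DecidableEq Q] : (lamp (Q := Q)).1 ^ n =
    ⟨Pi.mulSingle 1 (Multiplicative.ofAdd n), 1⟩ := by
  let ψ : Multiplicative ℤ →* RegularWreathProduct (Multiplicative ℤ) Q :=
    MonoidHom.mk' (fun n => ⟨Pi.mulSingle 1 n, 1⟩) fun m n => by
      ext <;> simp [Pi.mulSingle_mul]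
  have h1 : (lamp (Q := Q)).1 = ψ (Multiplicative.ofAdd 1) := by
    ext q
    · simp [lamp_left, ψ, Pi.mulSingle_apply]
    · rfl
  rw [h1, ← map_zpow, ← ofAdd_zsmul]
  simp [ψ]

theorem eq_top_of_lamp_mem_of_top_mem {H : Subgroup (RestrictedWreath (Multiplicative ℤ) Q)}
    (hl : lamp ∈ H) (ht : ∀ q, top q ∈ H) : H = ⊤ := by
  classical
  have key : ∀ s : Finset Q, ∀ w : RestrictedWreath (Multiplicative ℤ) Q, w.1.right = 1 →
      Function.mulSupport w.1.left ⊆ s → w ∈ H := by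
    intro s
    induction s using Finset.induction_on with
    | empty =>
      intro w hw hs
      have : w = 1 := by
        ext q
        · have : q ∉ Function.mulSupport w.1.left := fun h => by simpa using hs h
          simpa using this
        · simpa using hw
      rw [this]
      exact H.one_mem
    | insert a s ha ih =>
      intro w hw hs
      -- The base element supported at `a` with the same value there as `w`; dividing by it removes
      -- `a` from the support.
      let g := top a * lamp ^ (w.1.left a).toAdd * (top a)⁻¹
      have hg : g ∈ H := H.mul_mem (H.mul_mem (ht a) (H.zpow_mem hl _)) (H.inv_mem (ht a))
      have hgl : ∀ q, g.1.left q = if q = a then w.1.left a else 1 := by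
        intro q
        simp [g, lamp_zpow, top, Pi.mulSingle_apply, inv_mul_eq_one, eq_comm]
      have hgr : g.1.right = 1 := by simp [g, lamp_zpow, top]
      have h1 : g⁻¹ * w ∈ H := by
        refine ih _ (by simp [hgr, hw]) fun q hq => ?_
        have h2 : (g⁻¹ * w).1.left q = (g.1.left q)⁻¹ * w.1.left q := by
          simp [hgr]
        rw [Function.mem_mulSupport, h2, hgl] at hq
        have hqa : q ≠ a := by
          rintro rfl
          simp at hq
        have hq' : w.1.left q ≠ 1 := by simpa [hqa] using hq
        simpa [hqa] using hs hq'
      simpa using H.mul_mem hg h1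
  refine (Subgroup.eq_top_iff' H).2 fun w => ?_
  have hw : (Function.mulSupport w.1.left).Finite := w.2
  have h1 : w * (top w.1.right)⁻¹ ∈ H := by
    refine key hw.toFinset _ (by simp [top]) ?_
    simp [top]
  simpa using H.mul_mem h1 (ht w.1.right)

theorem fg (hQ : Group.FG Q) : Group.FG (RestrictedWreath (Multiplicative ℤ) Q) := by
  obtain ⟨S, hS⟩ := hQ.out
  classical
  refine ⟨⟨insert lamp (S.image top), eq_top_of_lamp_mem_of_top_mem
    (Subgroup.subset_closure (by simp)) fun q => ?_⟩⟩
  have h : (⊤ : Subgroup Q).map top ≤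
      Subgroup.closure ((insert lamp (S.image top) : Finset _) : Set _) := by
    rw [← hS, MonoidHom.map_closure]
    exact Subgroup.closure_mono (by simp)
  exact h ⟨q, trivial, rfl⟩

/-! ### The skew product action of `ℤ ≀ Q` -/

/-- The function on pairs of words by which an element of the base group of `ℤ ≀ Q` acts in the
skew product associated with an action `ρ` of `Q`. -/
noncomputable def cocycle (ρ : Q →* TreeAut 2) (f : Q → Multiplicative ℤ)
    (xs es : List (Fin 2)) : ℤ :=
  ∑ᶠ h, if (ρ h)⁻¹ xs = es then (f h).toAdd else 0

theorem finite_support_cocycle (ρ : Q →* TreeAut 2) {f : Q → Multiplicative ℤ}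
    (hf : (Function.mulSupport f).Finite) (xs es : List (Fin 2)) :
    (Function.support fun h => if (ρ h)⁻¹ xs = es then (f h).toAdd else 0).Finite := by
  refine hf.subset fun h hh h1 => hh ?_
  simp [h1]

/-- Substituting `q⁻¹ * h` for `h` turns translation of `g` into the action of `q` on `xs`; this is
the cocycle identity required by `skew_mul`. -/
theorem cocycle_mul (ρ : Q →* TreeAut 2) {f g : Q → Multiplicative ℤ}
    (hf : (Function.mulSupport f).Finite) (hg : (Function.mulSupport g).Finite) (q : Q) :
    cocycle ρ (f * fun x => g (q⁻¹ * x)) =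
      fun xs es => cocycle ρ f xs es + cocycle ρ g ((ρ q)⁻¹ xs) es := by
  funext xs es
  have h1 : cocycle ρ g ((ρ q)⁻¹ xs) es =
      ∑ᶠ h, if (ρ h)⁻¹ xs = es then (g (q⁻¹ * h)).toAdd else 0 := by
    rw [cocycle, ← finsum_comp_equiv (Equiv.mulLeft q⁻¹)]
    refine finsum_congr fun h => ?_
    simp only [Equiv.coe_mulLeft, map_mul, map_inv, mul_inv_rev, inv_inv, RelIso.mul_apply]
    rw [← RelIso.mul_apply (ρ q), mul_inv_cancel, RelIso.one_apply]
  have hg' : (Function.mulSupport fun x => g (q⁻¹ * x)).Finite :=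
    Set.Finite.preimage (mul_right_injective q⁻¹).injOn hg
  rw [h1, cocycle, cocycle, ← finsum_add_distrib (finite_support_cocycle ρ hf xs es)
    (finite_support_cocycle ρ hg' xs es)]
  refine finsum_congr fun h => ?_
  split_ifs <;> simp

/-- The action of `ℤ ≀ Q` on the binary tree associated with an action `ρ` of `Q`. -/
noncomputable def skewHom (ρ : Q →* TreeAut 2) :
    RestrictedWreath (Multiplicative ℤ) Q →* TreeAut 2 :=
  MonoidHom.mk' (fun w => skew (ρ w.1.right) (cocycle ρ w.1.left) 0) fun v w => by
    rw [skew_mul, ← cocycle_mul ρ v.2 w.2, ← map_mul]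
    rfl

theorem skewHom_injective (ρ : Q →* TreeAut 2) (hinj : Function.Injective ρ)
    (hρ : ∀ F : Finset Q, 1 ∉ F → ∃ u, ∀ q ∈ F, ρ q u ≠ u) :
    Function.Injective (skewHom ρ) := by
  refine (injective_iff_map_eq_one _).2 fun w hw => ?_
  change skew (ρ w.1.right) (cocycle ρ w.1.left) 0 = 1 at hw
  have h1 := eq_one_of_skew_eq_one hw
  rw [h1] at hw
  have hr : w.1.right = 1 := (injective_iff_map_eq_one ρ).1 hinj _ h1
  suffices hl : w.1.left = 1 from Subtype.ext (RegularWreathProduct.ext hl hr)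
  funext a
  classical
  have hfin : (Function.mulSupport w.1.left).Finite := w.2
  -- A word `u` moved by every `h⁻¹ * a` with `h ≠ a` in the support: `(ρ h)⁻¹ (ρ a u) = u` then
  -- fails for all these `h`.
  obtain ⟨u, hu⟩ := hρ ((hfin.toFinset.image fun h => h⁻¹ * a).erase 1) (by simp)
  obtain ⟨m, hm⟩ := exists_skew_append_eq_one (ρ a u) u (length_eq _ u) hw
  have hK : (fun xs' es' => cocycle ρ w.1.left (ρ a u ++ xs') (u ++ es')) =
      fun xs es => if state (ρ a)⁻¹ (ρ a u) xs = es then (w.1.left a).toAdd else 0 := by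
    funext xs es
    rw [cocycle, finsum_eq_single _ a]
    · rw [apply_append_state, ← RelIso.mul_apply, inv_mul_cancel, RelIso.one_apply]
      simp
    · intro h hh
      by_cases hf : w.1.left h = 1
      · simp [hf]
      · refine if_neg fun heq => hu (h⁻¹ * a) ?_ ?_
        · simp only [Finset.mem_erase, ne_eq, inv_mul_eq_one, hh, not_false_eq_true,
            Finset.mem_image, Set.Finite.mem_toFinset, true_and]
          exact ⟨h, hf, rfl⟩
        · rw [apply_append_state] at heq
          have := (List.append_inj heq (by rw [length_eq, length_eq])).1
          rwa [← map_inv, ← RelIso.mul_apply, ← map_mul] at this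
  rw [hK] at hm
  exact Multiplicative.toAdd.injective (eq_zero_of_skew_indicator_eq_one _ hm)

/-- Nothing is ever added to `y`, so only the state of `ρ q` has to be remembered. -/
theorem skewHom_top_isFiniteState (ρ : Q →* TreeAut 2) {q : Q} (hq : IsFiniteState (ρ q)) :
    IsFiniteState (skewHom ρ (top q)) := by
  have h0 : cocycle ρ 1 = 0 := by
    funext xs es
    simp [cocycle]
  refine isFiniteState_of_mem (k := 3) three_pos
    (T := (fun α => skew α 0 0) '' states (ρ q)) (hq.image _) ?_
    ⟨ρ q, ⟨[], state_nil _⟩, by rw [← h0]; rfl⟩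
  rintro _ ⟨_, ⟨v, rfl⟩, rfl⟩ u hu
  obtain ⟨x, e, y, rfl⟩ := List.length_eq_three.1 hu
  rw [state_skew]
  refine ⟨state (state (ρ q) v) [x], ⟨v ++ [x], state_append _ _ _⟩, ?_⟩
  have h1 : (digit y + 0 + (0 : List (Fin 2) → List (Fin 2) → ℤ)
      [letter (state (ρ q) v) x] [e]) / 2 = 0 := by
    have := digit_mem y
    simp only [Pi.zero_apply]
    omega
  rw [h1]
  rfl

theorem skewHom_lamp_isFiniteState (ρ : Q →* TreeAut 2) :
    IsFiniteState (skewHom ρ lamp) := by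
  let D : List (Fin 2) → List (Fin 2) → ℤ := fun xs es => if xs = es then 1 else 0
  have h0 : cocycle ρ (lamp (Q := Q)).1.left = D := by
    classical
    funext xs es
    rw [cocycle, finsum_eq_single _ 1]
    · simp [D, lamp_left]
    · intro h hh
      simp [lamp_left, hh]
  -- `D` means that the prefixes still agree, `0` that they have differed. The carry is at most `1`,
  -- as digit, carry and indicator sum to at most `3`.
  refine isFiniteState_of_mem (k := 3) three_pos
    (T := Set.image2 (skew 1) {D, 0} {0, 1}) (Set.Finite.image2 _ (by simp) (by simp)) ?_
    ⟨D, by simp, 0, by simp, by rw [← h0, ← map_one ρ]; rfl⟩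
  rintro _ ⟨K, hK, n, hn, rfl⟩ u hu
  obtain ⟨x, e, y, rfl⟩ := List.length_eq_three.1 hu
  rw [state_skew, state_one, letter_one]
  refine ⟨_, ?_, _, ?_, rfl⟩
  · rcases hK with rfl | rfl
    · by_cases hx : x = e
      · left
        funext xs es
        simp [shift, D, hx]
      · right
        funext xs es
        simp [shift, D, hx]
    · right
      rfl
  · have hK' : K [x] [e] = 0 ∨ K [x] [e] = 1 := by
      rcases hK with rfl | rfl
      · by_cases hx : x = e <;> simp [D, hx]
      · left
        rfl
    have hy := digit_mem y
    simp only [Set.mem_insert_iff, Set.mem_singleton_iff] at hn ⊢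
    omega

theorem embedsInFiniteState (hQ : EmbedsInFiniteState Q) :
    EmbedsInFiniteState (RestrictedWreath (Multiplicative ℤ) Q) := by
  classical
  obtain ⟨ρ, hinj, hfs⟩ := hQ
  let σ := restartHom.comp ρ
  have hσ : ∀ F : Finset Q, 1 ∉ F → ∃ u, ∀ q ∈ F, σ q u ≠ u := by
    intro F hF
    obtain ⟨u, hu⟩ := exists_forall_restartHom_ne (F.image ρ) (by
      rw [Finset.mem_image]
      rintro ⟨q, hq, h1⟩
      exact hF ((injective_iff_map_eq_one ρ).1 hinj q h1 ▸ hq))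
    exact ⟨u, fun q hq => hu _ (Finset.mem_image_of_mem ρ hq)⟩
  -- Faithfulness of the restarted action is the case of a singleton.
  have hσinj : Function.Injective σ := by
    refine (injective_iff_map_eq_one σ).2 fun q hq => ?_
    by_contra h
    obtain ⟨u, hu⟩ := hσ {q} (by simpa using Ne.symm h)
    exact hu q (by simp) (by rw [hq]; rfl)
  refine ⟨skewHom σ, skewHom_injective σ hσinj hσ, fun w => ?_⟩
  have h : (finiteStateGroup 2).comap (skewHom σ) = ⊤ :=
    eq_top_of_lamp_mem_of_top_mem (skewHom_lamp_isFiniteState σ) fun q =>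
      skewHom_top_isFiniteState σ (restartHom_isFiniteState (hfs q))
  exact (h ▸ Subgroup.mem_top w : w ∈ (finiteStateGroup 2).comap (skewHom σ))

end RestrictedWreath

/-! ### The ambient automata group and the theorem -/

/-- The subgroup generated by all states of finitely many finite-state automorphisms is an
automata group. -/
theorem isAutomataGroup_closure_states {m : ℕ} {S : Set (TreeAut m)} (hS : S.Finite)
    (hfs : ∀ α ∈ S, IsFiniteState α) :
    IsAutomataGroup (Subgroup.closure (⋃ α ∈ S, states α)) where
  fg := Subgroup.fg_iff _ |>.2 ⟨_, rfl, hS.biUnion hfs⟩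
  stateClosed := by
    intro α hα
    have h : ∀ u, state α u ∈ Subgroup.closure (⋃ α ∈ S, states α) := by
      induction hα using Subgroup.closure_induction with
      | mem β hβ =>
        intro u
        simp only [Set.mem_iUnion] at hβ
        obtain ⟨γ, hγ, v, rfl⟩ := hβ
        refine Subgroup.subset_closure (Set.mem_biUnion hγ ⟨v ++ u, state_append γ v u⟩)
      | one =>
        intro u
        rw [state_one]
        exact Subgroup.one_mem _
      | mul β γ _ _ hβ hγ =>
        intro u
        rw [state_mul]
        exact Subgroup.mul_mem _ (hβ _) (hγ _)
      | inv β _ hβ =>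
        intro u
        rw [state_inv]
        exact Subgroup.inv_mem _ (hβ _)
    rintro _ ⟨u, rfl⟩
    exact h u
  finiteState := by
    refine (Subgroup.closure_le _).2 (Set.iUnion₂_subset fun α hα => ?_)
    rintro _ ⟨u, rfl⟩
    refine (hfs α hα).subset ?_
    rintro _ ⟨v, rfl⟩
    exact ⟨u ++ v, state_append α u v⟩

theorem theoremD :
    ∃ φ : W3 →* finiteStateGroup 2, Function.Injective φ ∧
      ∃ G : Subgroup (TreeAut 2), IsAutomataGroup G ∧ ∀ w : W3, (φ w : TreeAut 2) ∈ G := by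
  obtain ⟨ρ, hinj, hfs⟩ : EmbedsInFiniteState W3 :=
    RestrictedWreath.embedsInFiniteState
      (RestrictedWreath.embedsInFiniteState embedsInFiniteState_int)
  have hfg : Group.FG W3 := RestrictedWreath.fg (RestrictedWreath.fg inferInstance)
  obtain ⟨S, hS⟩ := hfg.out
  refine ⟨ρ.codRestrict (finiteStateGroup 2) hfs, fun v w h => hinj (congrArg Subtype.val h),
    _, isAutomataGroup_closure_states (S := ρ '' S) (S.finite_toSet.image ρ) ?_, fun w => ?_⟩
  · rintro _ ⟨s, _, rfl⟩
    exact hfs s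
  · have h : (⊤ : Subgroup W3).map ρ ≤ Subgroup.closure (⋃ α ∈ ρ '' S, states α) := by
      rw [← hS, MonoidHom.map_closure]
      exact Subgroup.closure_mono fun α hα => Set.mem_biUnion hα ⟨[], state_nil α⟩
    exact h ⟨w, trivial, rfl⟩
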